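/- Let $(W,S)$ be a Coxeter system with length function $\ell$, and let $\ast$ be an automorphism of $W$ with $w^{\ast\ast}=w$ for all $w$ and $S^\ast=S$. Put $\mathbf I_\ast=\{w\in W: w^\ast=w^{-1}\}$. For $s\in S$ and $w\in\mathbf I_\ast$ let $s\ltimes w=sw$ if $sw=ws^\ast$, and $s\ltimes w=sws^\ast$ otherwise. A sequence $\sigma=(s_{i_1},\dots,s_{i_k})$ in $S$ is an $\mathbf I_\ast$-expression of $w$ if $w=s_{i_1}\ltimes(s_{i_2}\ltimes\cdots(s_{i_k}\ltimes 1)\cdots)$; it is reduced if $k$ is minimal, and then $\rho(w):=k$, $\sigma_w:=s_{i_1}s_{i_2}\cdots s_{i_k}\in W$, and $\ell^\ast(w)$ is the number of $t\in\{1,\dots,k\}$ such that $s_{i_t}w_t=w_ts_{i_t}^\ast$, where $w_t=s_{i_{t+1}}\ltimes\cdots\ltimes s_{i_k}\ltimes 1$ (this number depends only on $w$). Write $<$ for the strict Bruhat order on $W$. Let $\mathcal H_u$ be the Iwahori–Hecke algebra of $(W,S)$ over $\mathbb Q(u)$, with basis $\{T_w\}_{w\in W}$ and relations $T_wT_{w'}=T_{ww'}$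 if $\ell(ww')=\ell(w)+\ell(w')$ and $(T_s+1)(T_s-u^2)=0$ for $s\in S$. Let $M_u$ be the $\mathbb Q(u)$-vector space with basis $\{a_w\}_{w\in\mathbf I_\ast}$, with the (unique) $\mathcal H_u$-module structure of Lusztig and Vogan: for $s\in S$ and $w\in\mathbf I_\ast$, $$T_sa_w=\begin{cases}ua_w+(u+1)a_{sw}&\text{if } sw=ws^\ast>w,\\ (u^2-u-1)a_w+(u^2-u)a_{sw}&\text{if } sw=ws^\ast<w,\\ a_{sws^\ast}&\text{if } sw\ne ws^\ast \text{ and } sw>w,\\ (u^2-1)a_w+u^2a_{sws^\ast}&\text{if } sw\ne ws^\ast\text{ and } sw<w.\end{cases}$$ **Proposition.** Let $z\in\mathbf I_\ast$ and let $\sigma=(s_{i_1},\dots,s_{i_k})$ be a reduced $\mathbf I_\ast$-expression of $z$. (1) $k=\rho(z)$, and with $r=\ell(z)$ there are unique $s_{i_{k+1}},\dots,s_{i_r}\in S$ for which there exist integers $k\le t_k\le\cdots\le t_1=r$ such that for every $1\le a\le k$ the element $z_a:=s_{i_a}\ltimes\cdots\ltimes s_{i_k}\ltimes 1$ satisfies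 $z_a=s_{i_a}s_{i_{a+1}}\cdots s_{i_{t_a}}$, $\rho(z_a)=k-a+1$ and $\ell(z_a)=t_a-a+1$. (If $k=0$, then $r=0$ and the sequence is empty.) In particular $z=s_{i_1}\ltimes\cdots\ltimes s_{i_k}\ltimes 1=s_{i_1}\cdots s_{i_k}s_{i_{k+1}}\cdots s_{i_r}$. (2) We have $T_{\sigma_z}=T_{s_{i_1}}\cdots T_{s_{i_k}}$, and $$T_{\sigma_z}a_1=(u+1)^{\ell^\ast(z)}a_z+\sum_{w}L^{\sigma_z}_w a_w,\qquad L^{\sigma_z}_w\in u\mathbb Z[u],$$ a finite sum over elements $w\in\mathbf I_\ast$ with $\rho(w)<\rho(z)$ that have a reduced $\mathbf I_\ast$-expression $\sigma'$ with $\sigma'_w<\sigma_z$. -/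

import Mathlib

open Polynomial

noncomputable section

namespace InvolutionModule

universe u v

variable {B : Type u} {W : Type v} [Group W] {M : CoxeterMatrix B}

/-- The field `ℚ(u)` of rational functions in one indeterminate over `ℚ`. -/
abbrev Qu : Type := RatFunc ℚ

/-- The indeterminate `u`. -/
abbrev uu : Qu := RatFunc.X

/-- The polynomial `p ∈ ℤ[u]`, seen as an element of `ℚ(u)`. -/
def toQu (p : ℤ[X]) : Qu := Polynomial.aeval uu p

/-! ### Bruhat order -/

/-- One step up in the Bruhat graph: `y = x t` for a reflection `t`, with `ℓ(x) < ℓ(y)`. -/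
def BruhatStep (cs : CoxeterSystem M W) (x y : W) : Prop :=
  ∃ t : W, cs.IsReflection t ∧ y = x * t ∧ cs.length x < cs.length y

/-- The Bruhat order `x ≤ y`. -/
def BruhatLE (cs : CoxeterSystem M W) (x y : W) : Prop :=
  Relation.ReflTransGen (BruhatStep cs) x y

/-- The strict Bruhat order `x < y`. -/
def BruhatLT (cs : CoxeterSystem M W) (x y : W) : Prop :=
  BruhatLE cs x y ∧ x ≠ y

/-! ### The Iwahori--Hecke algebra -/

/-- The defining relations of the Iwahori--Hecke algebra with parameter `u²`. -/
inductive HeckeRel (cs : CoxeterSystem M W) : FreeAlgebra Qu W → FreeAlgebra Qu W → Prop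
  | one : HeckeRel cs (FreeAlgebra.ι Qu 1) 1
  | mul (w w' : W) (h : cs.length (w * w') = cs.length w + cs.length w') :
      HeckeRel cs (FreeAlgebra.ι Qu w * FreeAlgebra.ι Qu w') (FreeAlgebra.ι Qu (w * w'))
  | quad (i : B) :
      HeckeRel cs
        ((FreeAlgebra.ι Qu (cs.simple i) + 1) *
          (FreeAlgebra.ι Qu (cs.simple i) - algebraMap Qu (FreeAlgebra Qu W) (uu ^ 2)))
        0

/-- The Iwahori--Hecke algebra `H_u` over `ℚ(u)` of the Coxeter system, with parameter `u²`. -/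
abbrev Hecke (cs : CoxeterSystem M W) : Type v := RingQuot (HeckeRel cs)

/-- The standard basis element `T_w` of `H_u`. -/
def heckeT (cs : CoxeterSystem M W) (w : W) : Hecke cs :=
  RingQuot.mkAlgHom Qu (HeckeRel cs) (FreeAlgebra.ι Qu w)

/-! ### Twisted involutions -/

/-- An automorphism `*` of `W` with `** = id` and `S* = S`. -/
structure DiagramInvolution (cs : CoxeterSystem M W) where
  /-- the automorphism `w ↦ w*` -/
  aut : W ≃* W
  aut_aut : ∀ w : W, aut (aut w) = w
  aut_simple : ∀ i : B, ∃ j : B, aut (cs.simple i) = cs.simple j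

variable {cs : CoxeterSystem M W}

/-- The set `I_* = {w ∈ W | w* = w⁻¹}` of twisted involutions. -/
abbrev TwistedInv (st : DiagramInvolution cs) : Type v := {w : W // st.aut w = w⁻¹}

/-- The condition `s_i w = w s_i*`. -/
def Commutes (st : DiagramInvolution cs) (i : B) (w : TwistedInv st) : Prop :=
  cs.simple i * w.1 = w.1 * st.aut (cs.simple i)

open Classical in
/-- `s_i ⋉ w`, which is `s_i w` if `s_i w = w s_i*` and `s_i w s_i*` otherwise. -/
def ltimes (st : DiagramInvolution cs) (i : B) (w : TwistedInv st) : TwistedInv st :=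
  if h : Commutes st i w then
    ⟨cs.simple i * w.1, by
      have h' : cs.simple i * w.1 = w.1 * st.aut (cs.simple i) := h
      rw [h', map_mul, st.aut_aut, w.2, mul_inv_rev, ← map_inv, cs.inv_simple]
      have : w.1⁻¹ * (cs.simple i * w.1) * w.1⁻¹ =
          w.1⁻¹ * (w.1 * st.aut (cs.simple i)) * w.1⁻¹ := by rw [h']
      simpa [mul_assoc] using this⟩
  else
    ⟨cs.simple i * w.1 * st.aut (cs.simple i), by
      rw [map_mul, map_mul, st.aut_aut, w.2, mul_inv_rev, mul_inv_rev, ← map_inv,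
        cs.inv_simple, mul_assoc]⟩

/-- The identity element as a twisted involution. -/
def oneInv (st : DiagramInvolution cs) : TwistedInv st := ⟨1, by simp⟩

/-- `s_{i_1} ⋉ (s_{i_2} ⋉ ⋯ (s_{i_k} ⋉ 1))` for the word `(i_1, …, i_k)`. -/
def ltimesWord (st : DiagramInvolution cs) : List B → TwistedInv st
  | [] => oneInv st
  | i :: ω => ltimes st i (ltimesWord st ω)

/-- `σ` is a reduced `I_*`-expression of `z`: it is an `I_*`-expression of minimal length. -/
def IsReducedExpr (st : DiagramInvolution cs) (σ : List B) (z : TwistedInv st) : Prop :=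
  ltimesWord st σ = z ∧ ∀ σ' : List B, ltimesWord st σ' = z → σ.length ≤ σ'.length

/-- The rank `ρ(w)`: the length of the reduced `I_*`-expressions of `w`. -/
def rho (st : DiagramInvolution cs) (w : TwistedInv st) : ℕ :=
  sInf {k | ∃ σ : List B, IsReducedExpr st σ w ∧ σ.length = k}

open Classical in
/-- The number of `t` with `s_{i_t} w_t = w_t s_{i_t}*`, where
`w_t = s_{i_{t+1}} ⋉ ⋯ ⋉ s_{i_k} ⋉ 1`. Since `s ⋉ (s ⋉ w) = w`, these are the elements
obtained from `w_0 = s_{i_1} ⋉ ⋯ ⋉ s_{i_k} ⋉ 1` by `w_t = s_{i_t} ⋉ w_{t-1}`. -/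
def commCount (st : DiagramInvolution cs) : List B → ℕ
  | [] => 0
  | i :: ω => (if Commutes st i (ltimesWord st ω) then 1 else 0) + commCount st ω

/-- `ℓ^*(w)`: the common value of `commCount` on the reduced `I_*`-expressions of `w`. -/
def ellStar (st : DiagramInvolution cs) (w : TwistedInv st) : ℕ :=
  sInf {n | ∃ σ : List B, IsReducedExpr st σ w ∧ commCount st σ = n}

/-- The set `I_*(≺_σ z)` of those `w` with `ρ(w) < ρ(z)` that have a reduced `I_*`-expression
`σ'` with `σ'_w < σ_z`. -/
def precSet (st : DiagramInvolution cs) (σ : List B) (z : TwistedInv st) :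
    Set (TwistedInv st) :=
  {w | rho st w < rho st z ∧
    ∃ σ' : List B, IsReducedExpr st σ' w ∧ BruhatLT cs (cs.wordProd σ') (cs.wordProd σ)}

/-- `τ = (i_{k+1}, …, i_r)` continues the reduced `I_*`-expression `σ = (i_1, …, i_k)` of `z` to
a word of length `r = ℓ(z)` such that for some `k ≤ t_k ≤ ⋯ ≤ t_1 = r` each
`z_a = s_{i_a} ⋉ ⋯ ⋉ s_{i_k} ⋉ 1` equals `s_{i_a} s_{i_{a+1}} ⋯ s_{i_{t_a}}`, with
`ρ(z_a) = k - a + 1` and `ℓ(z_a) = t_a - a + 1`. Here the positions `a` are counted from `0`. -/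
def IsCompletion (st : DiagramInvolution cs) (σ τ : List B) (z : TwistedInv st) : Prop :=
  (σ ++ τ).length = cs.length z.1 ∧
  ∃ t : Fin σ.length → ℕ, Antitone t ∧
    ∀ a : Fin σ.length,
      σ.length ≤ t a ∧
      (a.1 = 0 → t a = (σ ++ τ).length) ∧
      (ltimesWord st (σ.drop a.1)).1 = cs.wordProd (((σ ++ τ).take (t a)).drop a.1) ∧
      rho st (ltimesWord st (σ.drop a.1)) + a.1 = σ.length ∧
      cs.length (ltimesWord st (σ.drop a.1)).1 + a.1 = t a

/-! ### The `u`-deformed involution module -/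

/-- The `ℚ(u)`-vector space `M_u` with basis `{a_z | z ∈ I_*}`. -/
abbrev Mu (st : DiagramInvolution cs) : Type v := TwistedInv st →₀ Qu

/-- The basis vector `a_z`. -/
def aVec (st : DiagramInvolution cs) (z : TwistedInv st) : Mu st := Finsupp.single z 1

open Classical in
/-- The vector that the Lusztig--Vogan formulas prescribe for `T_{s_i} a_w`. For a simple
reflection `s`, `sw > w` in the Bruhat order means `ℓ(sw) > ℓ(w)`. -/
def lvVec (st : DiagramInvolution cs) (i : B) (w : TwistedInv st) : Mu st :=
  if Commutes st i w then
    if cs.length w.1 < cs.length (cs.simple i * w.1) then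
      uu • aVec st w + (uu + 1) • aVec st (ltimes st i w)
    else
      (uu ^ 2 - uu - 1) • aVec st w + (uu ^ 2 - uu) • aVec st (ltimes st i w)
  else
    if cs.length w.1 < cs.length (cs.simple i * w.1) then
      aVec st (ltimes st i w)
    else
      (uu ^ 2 - 1) • aVec st w + uu ^ 2 • aVec st (ltimes st i w)

/-- The `ℚ(u)`-linear operator by which `T_{s_i}` acts on `M_u`. -/
def lvOp (st : DiagramInvolution cs) (i : B) : Module.End Qu (Mu st) :=
  Finsupp.linearCombination Qu (lvVec st i)

/-- An `H_u`-module structure on the vector space `M_u` (an algebra homomorphism from `H_u` to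
its endomorphisms) is the Lusztig--Vogan structure if `T_{s_i} a_w` is given by the
Lusztig--Vogan formulas. There is at most one such structure, as the `T_{s_i}` generate `H_u`. -/
def IsLVAction (st : DiagramInvolution cs) (φ : Hecke cs →ₐ[Qu] Module.End Qu (Mu st)) : Prop :=
  ∀ (i : B) (w : TwistedInv st), φ (heckeT cs (cs.simple i)) (aVec st w) = lvVec st i w

end InvolutionModule

end

/-! The proof rests on one equivalence, `isReducedExpr_iff`: an `I_*`-expression is reduced exactly
when every letter is an ascent of the element built so far. Taking the shorter of `w` and `s ⋉ w` is
monotone for the Bruhat order (`bruhatLE_ltimesMin`), which gives a subword property for ascending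
words (`exists_sublist_of_le`) and hence an exchange property (`exists_sublist_ltimes`). So each
letter changes the rank by exactly one, upwards precisely at ascents.

An ascent adds 1 to the length if it commutes and 2 otherwise. Prepending every letter `s`, and
appending `s*` at the non-commuting steps, therefore yields a reduced word of `z` that begins with
`σ`. This gives the completion in (1) and, since its prefix `σ` is reduced, the factorization of
`T_{σ_z}`. It also shows `ℓ^* = 2ρ - ℓ`, which does not depend on the expression.

For the expansion, letters are added on the left. A commuting ascent multiplies the leading
coefficient by `u + 1` and leaves behind a multiple of `u`; a non-commuting ascent only moves the
leading vector. All structure constants lie in `ℤ[u]`, so earlier error terms keep coefficients in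
`u ℤ[u]`. Their indices stay in the required set because `precSet` is carried along both by `w ↦ w`
and by `w ↦ s ⋉ w` (`IsAscending.ltimes_mem_precSet_cons`). -/

namespace InvolutionModule

/-! ### Strong exchange and monotonicity properties of the Bruhat order. -/

section BruhatOrder

variable {B W : Type*} [Group W] {M : CoxeterMatrix B} (cs : CoxeterSystem M W)

/-! ### The reflection cocycle and the exchange property -/

open Classical in
/-- The permutation `(x, ε) ↦ (s_i x s_i, ε + [x = s_i])` of `W × ℤ/2`. -/
noncomputable def signedConj (i : B) : Equiv.Perm (W × ZMod 2) where
  toFun p := (cs.simple i * p.1 * cs.simple i, p.2 + if p.1 = cs.simple i then 1 else 0)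
  invFun p := (cs.simple i * p.1 * cs.simple i, p.2 + if p.1 = cs.simple i then 1 else 0)
  left_inv := by
    rintro ⟨x, e⟩
    have h : cs.simple i * x * cs.simple i = cs.simple i ↔ x = cs.simple i := by
      rw [mul_eq_right, mul_eq_one_iff_inv_eq, cs.inv_simple, eq_comm]
    have h2 : (1 + 1 : ZMod 2) = 0 := by decide
    simp only [h]
    by_cases hx : x = cs.simple i <;> simp [hx, mul_assoc, add_assoc, h2]
  right_inv := by
    rintro ⟨x, e⟩
    have h : cs.simple i * x * cs.simple i = cs.simple i ↔ x = cs.simple i := by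
      rw [mul_eq_right, mul_eq_one_iff_inv_eq, cs.inv_simple, eq_comm]
    have h2 : (1 + 1 : ZMod 2) = 0 := by decide
    simp only [h]
    by_cases hx : x = cs.simple i <;> simp [hx, mul_assoc, add_assoc, h2]

open Classical in
theorem signedConj_apply (i : B) (x : W) (e : ZMod 2) :
    signedConj cs i (x, e) =
      (cs.simple i * x * cs.simple i, e + if x = cs.simple i then 1 else 0) := rfl

theorem simple_mul_pow_mul_inv (i j : B) (n : ℕ) :
    (cs.simple j * cs.simple i) ^ n * cs.simple j =
      cs.simple j * ((cs.simple j * cs.simple i) ^ n)⁻¹ := by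
  have h : SemiconjBy (cs.simple j) (cs.simple j * cs.simple i)⁻¹ (cs.simple j * cs.simple i) := by
    simp [SemiconjBy, mul_assoc]
  have := (h.pow_right n).eq
  rw [inv_pow] at this
  exact this.symm

-- The sum records when the alternating conjugates of `x` meet `s_j` or `s_i`; pulled back to `x`,
-- these are the reflections `(s_j s_i)^k s_j`.
open Classical in
theorem signedConj_mul_pow_apply (i j : B) (n : ℕ) (x : W) (e : ZMod 2) :
    ((signedConj cs i * signedConj cs j) ^ n) (x, e) =
      ((cs.simple i * cs.simple j) ^ n * x * ((cs.simple i * cs.simple j) ^ n)⁻¹,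
        e + ∑ k ∈ Finset.range (2 * n),
          if x = (cs.simple j * cs.simple i) ^ k * cs.simple j then 1 else 0) := by
  induction n with
  | zero => simp
  | succ n ih =>
    have hc : cs.simple i * cs.simple j = (cs.simple j * cs.simple i)⁻¹ := by simp
    have h1 : (cs.simple i * cs.simple j) ^ n * x * ((cs.simple i * cs.simple j) ^ n)⁻¹ =
        cs.simple j ↔ x = (cs.simple j * cs.simple i) ^ (2 * n) * cs.simple j := by
      rw [hc, inv_pow, inv_inv, mul_assoc, inv_mul_eq_iff_eq_mul, ← eq_mul_inv_iff_mul_eq,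
        mul_assoc, ← simple_mul_pow_mul_inv, ← mul_assoc, ← pow_add, two_mul]
    have h2 : cs.simple j * ((cs.simple i * cs.simple j) ^ n * x *
        ((cs.simple i * cs.simple j) ^ n)⁻¹) * cs.simple j = cs.simple i ↔
        x = (cs.simple j * cs.simple i) ^ (2 * n + 1) * cs.simple j := by
      rw [hc, inv_pow, inv_inv, mul_assoc, ← cs.inv_simple j, inv_mul_eq_iff_eq_mul,
        mul_inv_eq_iff_eq_mul, cs.inv_simple, mul_assoc, inv_mul_eq_iff_eq_mul,
        ← eq_mul_inv_iff_mul_eq, mul_assoc, mul_assoc, mul_assoc, ← simple_mul_pow_mul_inv,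
        show 2 * n + 1 = n + (1 + n) by ring, pow_add, pow_add]
      simp [mul_assoc]
    rw [pow_succ', Equiv.Perm.mul_apply, ih, Equiv.Perm.mul_apply, signedConj_apply,
      signedConj_apply, show 2 * (n + 1) = 2 * n + 1 + 1 by ring, Finset.sum_range_succ,
      Finset.sum_range_succ]
    simp only [h1, h2, Prod.mk.injEq]
    refine ⟨?_, by ring⟩
    simp [pow_succ', mul_assoc]

/-- With `m = M i j`, the terms `k` and `m + k` of the sum agree, so it vanishes mod 2. -/
theorem isLiftable_signedConj : M.IsLiftable (signedConj cs) := by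
  classical
  intro i j
  ext1 ⟨x, e⟩
  rw [signedConj_mul_pow_apply, cs.simple_mul_simple_pow, two_mul, Finset.sum_range_add]
  have h : ∀ k, (cs.simple j * cs.simple i) ^ (M i j + k) = (cs.simple j * cs.simple i) ^ k := by
    intro k
    rw [pow_add, cs.simple_mul_simple_pow', one_mul]
  simp only [h, one_mul, inv_one, mul_one, CharTwo.add_self_eq_zero, add_zero,
    Equiv.Perm.coe_one, id]

/-- The action of `W` on `W × ℤ/2` extending `signedConj`. -/
noncomputable def signedConjHom : W →* Equiv.Perm (W × ZMod 2) :=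
  cs.lift ⟨signedConj cs, isLiftable_signedConj cs⟩

/-- The reflection cocycle: for a reflection `t`, it is `1` exactly when `ℓ(wt) < ℓ(w)`. -/
noncomputable def reflCocycle (w t : W) : ZMod 2 := (signedConjHom cs w (t, 0)).2

theorem signedConjHom_simple (i : B) : signedConjHom cs (cs.simple i) = signedConj cs i :=
  cs.lift_apply_simple (isLiftable_signedConj cs) i

theorem signedConjHom_apply (w t : W) (e : ZMod 2) :
    signedConjHom cs w (t, e) = (w * t * w⁻¹, e + reflCocycle cs w t) := by
  unfold reflCocycle
  induction w using cs.simple_induction_left generalizing t e with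
  | one => simp
  | mul_simple_left w i ih =>
    simp only [map_mul, Equiv.Perm.mul_apply, signedConjHom_simple]
    rw [ih t e, ih t 0]
    simp [signedConj_apply, mul_assoc, add_assoc]

theorem reflCocycle_mul (v w t : W) :
    reflCocycle cs (v * w) t = reflCocycle cs w t + reflCocycle cs v (w * t * w⁻¹) := by
  conv_lhs => rw [reflCocycle, map_mul, Equiv.Perm.mul_apply, signedConjHom_apply,
    signedConjHom_apply]
  simp

open Classical in
theorem reflCocycle_simple (i : B) (t : W) :
    reflCocycle cs (cs.simple i) t = if t = cs.simple i then 1 else 0 := by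
  rw [reflCocycle, signedConjHom_simple, signedConj_apply, zero_add]

theorem reflCocycle_one (t : W) : reflCocycle cs 1 t = 0 := by
  simp [reflCocycle]

/-- The cocycle counts, mod 2, the occurrences of `t` in the right inversion sequence of any word
for `w`. -/
theorem mem_rightInvSeq_of_reflCocycle_ne_zero (ω : List B) (t : W)
    (h : reflCocycle cs (cs.wordProd ω) t ≠ 0) : t ∈ cs.rightInvSeq ω := by
  classical
  induction ω with
  | nil => simp [reflCocycle_one] at h
  | cons i ω ih =>
    rw [cs.wordProd_cons, reflCocycle_mul, reflCocycle_simple] at h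
    rw [CoxeterSystem.rightInvSeq, List.mem_cons]
    by_cases ht : cs.wordProd ω * t * (cs.wordProd ω)⁻¹ = cs.simple i
    · left
      rw [← ht]
      simp [mul_assoc]
    · right
      apply ih
      simpa [ht] using h

theorem length_mul_lt_of_reflCocycle_ne_zero (w t : W) (h : reflCocycle cs w t ≠ 0) :
    cs.length (w * t) < cs.length w := by
  obtain ⟨ω, hω, rfl⟩ := cs.exists_isReduced w
  exact (cs.isRightInversion_of_mem_rightInvSeq hω
    (mem_rightInvSeq_of_reflCocycle_ne_zero cs ω t h)).2

/-- For `t = w s w⁻¹` the contributions of `w` and `w⁻¹` cancel, since the cocycle of `w w⁻¹ = 1` is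
zero; the middle `s` contributes 1. -/
theorem reflCocycle_self {t : W} (ht : cs.IsReflection t) : reflCocycle cs t t = 1 := by
  obtain ⟨w, i, rfl⟩ := ht
  have h := reflCocycle_mul cs w w⁻¹ (w * cs.simple i * w⁻¹)
  rw [mul_inv_cancel, reflCocycle_one] at h
  have e : w⁻¹ * (w * cs.simple i * w⁻¹) * w⁻¹⁻¹ = cs.simple i := by simp [mul_assoc]
  rw [e] at h
  rw [reflCocycle_mul, reflCocycle_mul, e, reflCocycle_simple, if_pos rfl]
  rw [show cs.simple i * cs.simple i * (cs.simple i)⁻¹ = cs.simple i by simp]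
  linear_combination -h

theorem reflCocycle_eq_one_iff {w t : W} (ht : cs.IsReflection t) :
    reflCocycle cs w t = 1 ↔ cs.length (w * t) < cs.length w := by
  refine ⟨fun h => length_mul_lt_of_reflCocycle_ne_zero cs w t (by simp [h]), fun h => ?_⟩
  by_contra hne
  -- Passing from `w` to `w t` flips the cocycle at `t`, so otherwise `w = (w t) t` would be shorter
  -- than `w t`.
  have h2 : reflCocycle cs (w * t) t ≠ 0 := by
    rw [reflCocycle_mul, reflCocycle_self cs ht, mul_inv_cancel_right]
    generalize reflCocycle cs w t = a at hne
    revert a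
    decide
  have := length_mul_lt_of_reflCocycle_ne_zero cs _ _ h2
  rw [mul_assoc, ht.mul_self, mul_one] at this
  omega

/-- If `x < xt` then left multiplication by `s_i` preserves this, unless `s_i x = x t`. -/
theorem simple_mul_eq_or_length_lt {x t : W} (ht : cs.IsReflection t)
    (h : cs.length x < cs.length (x * t)) (i : B) :
    cs.simple i * x = x * t ∨ cs.length (cs.simple i * x) < cs.length (cs.simple i * (x * t)) := by
  classical
  by_cases hx : x * t * x⁻¹ = cs.simple i
  · left
    rw [← hx]
    simp
  · right
    have h1 : ¬ reflCocycle cs x t = 1 := by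
      rw [reflCocycle_eq_one_iff cs ht]
      omega
    have h2 : ¬ reflCocycle cs (cs.simple i * x) t = 1 := by
      rwa [reflCocycle_mul, reflCocycle_simple, if_neg hx, add_zero]
    rw [reflCocycle_eq_one_iff cs ht] at h2
    have := ht.length_mul_left_ne (cs.simple i * x)
    rw [← mul_assoc]
    omega

/-! ### Lifting in the Bruhat order -/

variable {cs}

theorem BruhatStep.le {x y : W} (h : BruhatStep cs x y) : BruhatLE cs x y := .single h

theorem BruhatLE.refl (x : W) : BruhatLE cs x x := Relation.ReflTransGen.refl

theorem BruhatLE.trans {x y z : W} (h : BruhatLE cs x y) (h' : BruhatLE cs y z) :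
    BruhatLE cs x z := Relation.ReflTransGen.trans h h'

theorem BruhatLE.length_le {x y : W} (h : BruhatLE cs x y) : cs.length x ≤ cs.length y := by
  induction h with
  | refl => rfl
  | tail _ h ih =>
    obtain ⟨t, _, _, h⟩ := h
    omega

theorem BruhatLE.eq_of_length_le {x y : W} (h : BruhatLE cs x y)
    (hl : cs.length y ≤ cs.length x) : x = y := by
  cases h with
  | refl => rfl
  | tail h₁ h₂ =>
    obtain ⟨t, _, _, h⟩ := h₂
    have := BruhatLE.length_le h₁
    omega

theorem BruhatLT.length_lt {x y : W} (h : BruhatLT cs x y) : cs.length x < cs.length y := by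
  by_contra hl
  exact h.2 (h.1.eq_of_length_le (by omega))

theorem BruhatLT.trans_le {x y z : W} (h : BruhatLT cs x y) (h' : BruhatLE cs y z) :
    BruhatLT cs x z := by
  refine ⟨h.1.trans h', ?_⟩
  rintro rfl
  have := h.length_lt
  have := h'.length_le
  omega

theorem BruhatLE.trans_lt {x y z : W} (h : BruhatLE cs x y) (h' : BruhatLT cs y z) :
    BruhatLT cs x z := by
  refine ⟨h.trans h'.1, ?_⟩
  rintro rfl
  have := h'.length_lt
  have := h.length_le
  omega

theorem BruhatLE.inv {x y : W} (h : BruhatLE cs x y) : BruhatLE cs x⁻¹ y⁻¹ := by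
  induction h with
  | refl => exact .refl _
  | @tail y z _ h ih =>
    obtain ⟨t, ht, rfl, hl⟩ := h
    refine ih.trans (BruhatStep.le ⟨y * t * y⁻¹, ht.conj y, ?_, ?_⟩)
    · rw [mul_inv_rev, ht.inv]
      simp [mul_assoc]
    · rwa [cs.length_inv, cs.length_inv]

theorem bruhatStep_simple_mul {x : W} {i : B} (h : cs.length x < cs.length (cs.simple i * x)) :
    BruhatStep cs x (cs.simple i * x) := by
  refine ⟨x⁻¹ * cs.simple i * x, ?_, by simp [mul_assoc], h⟩
  simpa using (cs.isReflection_simple i).conj x⁻¹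

theorem bruhatStep_simple_mul' {x : W} {i : B} (h : cs.length (cs.simple i * x) < cs.length x) :
    BruhatStep cs (cs.simple i * x) x := by
  have := bruhatStep_simple_mul (cs := cs) (x := cs.simple i * x) (i := i) (by simpa using h)
  simpa using this

open Classical in
/-- The shorter one of `w` and `s_i w`. -/
noncomputable def leftMin (cs : CoxeterSystem M W) (i : B) (w : W) : W :=
  if cs.length w < cs.length (cs.simple i * w) then w else cs.simple i * w

open Classical in
/-- The longer one of `w` and `s_i w`. -/
noncomputable def leftMax (cs : CoxeterSystem M W) (i : B) (w : W) : W :=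
  if cs.length w < cs.length (cs.simple i * w) then cs.simple i * w else w

/-- The lifting property, stated as monotonicity so that it passes to chains. Either `s_i` exchanges
`x` and `y`, or `s_i x < s_i y` by the same reflection, and the four ascent patterns follow. -/
theorem bruhatLE_leftMin_leftMax_of_step (i : B) {x y : W} (h : BruhatStep cs x y) :
    BruhatLE cs (leftMin cs i x) (leftMin cs i y) ∧
      BruhatLE cs (leftMax cs i x) (leftMax cs i y) := by
  obtain ⟨t, ht, rfl, hl⟩ := h
  have hxy : BruhatStep cs x (x * t) := ⟨t, ht, rfl, hl⟩
  rcases simple_mul_eq_or_length_lt cs ht hl i with h | h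
  · rw [← h] at hl ⊢
    have : ¬ cs.length (cs.simple i * x) < cs.length x := by omega
    simp [leftMin, leftMax, hl, this, BruhatLE.refl]
  · have hs : BruhatStep cs (cs.simple i * x) (cs.simple i * (x * t)) :=
      ⟨t, ht, by rw [mul_assoc], h⟩
    have hx := cs.length_simple_mul_ne x i
    have hy := cs.length_simple_mul_ne (x * t) i
    unfold leftMin leftMax
    split_ifs with h1 h2 h2
    · exact ⟨hxy.le, hs.le⟩
    · exact ⟨(bruhatStep_simple_mul h1).le.trans hs.le,
        hs.le.trans (bruhatStep_simple_mul' (by omega)).le⟩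
    · exact ⟨(bruhatStep_simple_mul' (by omega)).le.trans hxy.le,
        hxy.le.trans (bruhatStep_simple_mul h2).le⟩
    · exact ⟨hs.le, hxy.le⟩

theorem BruhatLE.leftMin {x y : W} (h : BruhatLE cs x y) (i : B) :
    BruhatLE cs (leftMin cs i x) (InvolutionModule.leftMin cs i y) := by
  induction h with
  | refl => exact .refl _
  | tail _ h ih => exact ih.trans (bruhatLE_leftMin_leftMax_of_step i h).1

theorem BruhatLE.leftMax {x y : W} (h : BruhatLE cs x y) (i : B) :
    BruhatLE cs (leftMax cs i x) (InvolutionModule.leftMax cs i y) := by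
  induction h with
  | refl => exact .refl _
  | tail _ h ih => exact ih.trans (bruhatLE_leftMin_leftMax_of_step i h).2

theorem leftMin_le (i : B) (w : W) : BruhatLE cs (leftMin cs i w) w := by
  have := cs.length_simple_mul_ne w i
  unfold leftMin
  split_ifs with h
  · exact .refl _
  · exact (bruhatStep_simple_mul' (by omega)).le

theorem simple_mul_le_leftMax (i : B) (w : W) : BruhatLE cs (cs.simple i * w) (leftMax cs i w) := by
  have := cs.length_simple_mul_ne w i
  unfold leftMax
  split_ifs with h
  · exact .refl _
  · exact (bruhatStep_simple_mul' (by omega)).le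

/-- The shorter one of `w` and `w s_i`. -/
noncomputable def rightMin (cs : CoxeterSystem M W) (i : B) (w : W) : W :=
  (leftMin cs i w⁻¹)⁻¹

theorem BruhatLE.rightMin {x y : W} (h : BruhatLE cs x y) (i : B) :
    BruhatLE cs (rightMin cs i x) (InvolutionModule.rightMin cs i y) :=
  (h.inv.leftMin i).inv

theorem rightMin_le (i : B) (w : W) : BruhatLE cs (rightMin cs i w) w := by
  simpa [rightMin] using (leftMin_le (cs := cs) i w⁻¹).inv

open Classical in
theorem rightMin_eq (i : B) (w : W) :
    rightMin cs i w =
      if cs.length w < cs.length (w * cs.simple i) then w else w * cs.simple i := by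
  have : cs.length (cs.simple i * w⁻¹) = cs.length (w * cs.simple i) := by
    rw [← cs.length_inv]
    simp
  rw [rightMin, leftMin, cs.length_inv, this]
  split_ifs <;> simp

theorem bruhatLE_simple_mul {x y : W} (h : BruhatLE cs x y) {i : B}
    (hy : cs.length y < cs.length (cs.simple i * y)) :
    BruhatLE cs (cs.simple i * x) (cs.simple i * y) := by
  have := (simple_mul_le_leftMax i x).trans (h.leftMax i)
  rwa [leftMax, if_pos hy] at this

theorem bruhatLE_wordProd_of_sublist {ω' ω : List B} (h : ω'.Sublist ω) (hω : cs.IsReduced ω) :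
    BruhatLE cs (cs.wordProd ω') (cs.wordProd ω) := by
  induction h with
  | slnil => exact .refl _
  | @cons ω' ω i _ ih =>
    have hω' : cs.IsReduced ω := by simpa using hω.drop 1
    have hl : cs.length (cs.wordProd ω) < cs.length (cs.simple i * cs.wordProd ω) := by
      rw [← cs.wordProd_cons, hω.eq, hω'.eq]
      simp
    rw [cs.wordProd_cons]
    exact (ih hω').trans (bruhatStep_simple_mul hl).le
  | @cons_cons ω' ω i _ ih =>
    have hω' : cs.IsReduced ω := by simpa using hω.drop 1
    have hl : cs.length (cs.wordProd ω) < cs.length (cs.simple i * cs.wordProd ω) := by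
      rw [← cs.wordProd_cons, hω.eq, hω'.eq]
      simp
    rw [cs.wordProd_cons, cs.wordProd_cons]
    exact bruhatLE_simple_mul (ih hω') hl

end BruhatOrder

/-! ### Exchange property and rank function for twisted involutions. -/

section TwistedInvolutions

variable {B W : Type*} [Group W] {M : CoxeterMatrix B} {cs : CoxeterSystem M W}
  (st : DiagramInvolution cs)

/-! ### Twisted conjugation by a simple reflection -/

/-- An index `j` with `s_i* = s_j`. -/
noncomputable def starIdx (i : B) : B := (st.aut_simple i).choose

theorem aut_simple_eq (i : B) : st.aut (cs.simple i) = cs.simple (starIdx st i) :=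
  (st.aut_simple i).choose_spec

theorem length_aut (w : W) : cs.length (st.aut w) = cs.length w := by
  have key : ∀ w, cs.length (st.aut w) ≤ cs.length w := by
    intro w
    obtain ⟨ω, hω, rfl⟩ := cs.exists_isReduced w
    have : st.aut (cs.wordProd ω) = cs.wordProd (ω.map (starIdx st)) := by
      simp only [CoxeterSystem.wordProd, map_list_prod, List.map_map]
      congr 2
      funext i
      exact aut_simple_eq st i
    rw [this, hω.eq]
    simpa using cs.length_wordProd_le (ω.map (starIdx st))
  refine le_antisymm (key w) ?_
  simpa [st.aut_aut] using key (st.aut w)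

variable {st}

theorem aut_simple_mul (i : B) (w : TwistedInv st) :
    w.1 * st.aut (cs.simple i) = (st.aut (cs.simple i * w.1))⁻¹ := by
  rw [map_mul, w.2, mul_inv_rev, inv_inv, ← map_inv, cs.inv_simple]

theorem length_mul_aut_simple (i : B) (w : TwistedInv st) :
    cs.length (w.1 * st.aut (cs.simple i)) = cs.length (cs.simple i * w.1) := by
  rw [aut_simple_mul, cs.length_inv, length_aut]

theorem isReflection_aut_simple (i : B) : cs.IsReflection (st.aut (cs.simple i)) := by
  rw [aut_simple_eq]
  exact cs.isReflection_simple _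

/-- `s_i w > w`. -/
def IsAscent (st : DiagramInvolution cs) (i : B) (w : TwistedInv st) : Prop :=
  cs.length w.1 < cs.length (cs.simple i * w.1)

theorem not_isAscent_iff {i : B} {w : TwistedInv st} :
    ¬ IsAscent st i w ↔ cs.length (cs.simple i * w.1) + 1 = cs.length w.1 := by
  unfold IsAscent
  have := cs.length_simple_mul w.1 i
  omega

theorem ltimes_val_of_commutes {i : B} {w : TwistedInv st} (h : Commutes st i w) :
    (ltimes st i w).1 = cs.simple i * w.1 := by
  rw [ltimes, dif_pos h]

theorem ltimes_val_of_not_commutes {i : B} {w : TwistedInv st} (h : ¬ Commutes st i w) :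
    (ltimes st i w).1 = cs.simple i * w.1 * st.aut (cs.simple i) := by
  rw [ltimes, dif_neg h]

theorem aut_simple_mul_self (st : DiagramInvolution cs) (i : B) :
    st.aut (cs.simple i) * st.aut (cs.simple i) = 1 := by
  rw [← map_mul, cs.simple_mul_simple_self, map_one]

theorem commutes_ltimes_iff {i : B} {w : TwistedInv st} :
    Commutes st i (ltimes st i w) ↔ Commutes st i w := by
  by_cases h : Commutes st i w
  · refine iff_of_true ?_ h
    unfold Commutes at h ⊢
    rw [ltimes_val_of_commutes h, mul_assoc, ← h]
  · refine iff_of_false ?_ h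
    unfold Commutes at h ⊢
    rw [ltimes_val_of_not_commutes h]
    intro h'
    apply h
    rw [mul_assoc _ (st.aut (cs.simple i)), aut_simple_mul_self, mul_one, ← mul_assoc,
      cs.simple_mul_simple_cancel_left] at h'
    exact h'.symm

@[simp]
theorem ltimes_ltimes (i : B) (w : TwistedInv st) : ltimes st i (ltimes st i w) = w := by
  apply Subtype.ext
  by_cases h : Commutes st i w
  · rw [ltimes_val_of_commutes (commutes_ltimes_iff.2 h), ltimes_val_of_commutes h]
    simp
  · rw [ltimes_val_of_not_commutes (mt commutes_ltimes_iff.1 h), ltimes_val_of_not_commutes h,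
      mul_assoc, mul_assoc _ _ (st.aut (cs.simple i)), aut_simple_mul_self]
    simp

theorem length_ltimes_of_commutes {i : B} {w : TwistedInv st} (ha : IsAscent st i w)
    (h : Commutes st i w) : cs.length (ltimes st i w).1 = cs.length w.1 + 1 := by
  rw [ltimes_val_of_commutes h]
  unfold IsAscent at ha
  have := cs.length_simple_mul w.1 i
  omega

theorem length_ltimes_of_not_commutes {i : B} {w : TwistedInv st} (ha : IsAscent st i w)
    (h : ¬ Commutes st i w) : cs.length (ltimes st i w).1 = cs.length w.1 + 2 := by
  rw [ltimes_val_of_not_commutes h]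
  unfold IsAscent at ha
  have h1 := cs.length_simple_mul w.1 i
  have h2 := length_mul_aut_simple i w
  -- Since `w < w s*`, either `s w = w s*`, which is excluded, or `s w < s w s*`.
  have h3 := (simple_mul_eq_or_length_lt cs (isReflection_aut_simple (st := st) i)
    (x := w.1) (by omega) i).resolve_left h
  rw [aut_simple_eq] at h2 h3 ⊢
  rw [← mul_assoc] at h3
  have h4 := cs.length_mul_simple (cs.simple i * w.1) (starIdx st i)
  omega

theorem length_ltimes_of_not_ascent {i : B} {w : TwistedInv st} (ha : ¬ IsAscent st i w)
    (h : ¬ Commutes st i w) : cs.length (ltimes st i w).1 + 2 = cs.length w.1 := by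
  rw [ltimes_val_of_not_commutes h]
  rw [not_isAscent_iff] at ha
  have h2 := length_mul_aut_simple i w
  have h4 := cs.length_mul_simple (cs.simple i * w.1) (starIdx st i)
  rw [← aut_simple_eq] at h4
  by_contra hne
  -- If `s w < s w s*`, multiplying by `s` on the left gives either `w = s w s*`, the commuting
  -- case, or `w < w s*`, which contradicts the descent.
  rcases simple_mul_eq_or_length_lt cs (isReflection_aut_simple (st := st) i)
    (x := cs.simple i * w.1) (by omega) i with h5 | h5
  · apply h
    unfold Commutes
    rw [cs.simple_mul_simple_cancel_left] at h5
    conv_lhs => rw [h5]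
    simp [mul_assoc]
  · rw [mul_assoc, cs.simple_mul_simple_cancel_left, cs.simple_mul_simple_cancel_left] at h5
    omega

theorem isAscent_ltimes_iff {i : B} {w : TwistedInv st} :
    IsAscent st i (ltimes st i w) ↔ ¬ IsAscent st i w := by
  by_cases h : Commutes st i w
  · unfold IsAscent
    rw [ltimes_val_of_commutes h, cs.simple_mul_simple_cancel_left]
    have := cs.length_simple_mul w.1 i
    omega
  · have h2 := length_mul_aut_simple i w
    have h3 : cs.simple i * (ltimes st i w).1 = w.1 * st.aut (cs.simple i) := by
      rw [ltimes_val_of_not_commutes h]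
      simp [mul_assoc]
    by_cases ha : IsAscent st i w
    · have h1 := length_ltimes_of_not_commutes ha h
      have := cs.length_simple_mul w.1 i
      simp only [IsAscent, h3] at ha ⊢
      omega
    · have h1 := length_ltimes_of_not_ascent ha h
      rw [iff_true_right ha, IsAscent, h3]
      rw [not_isAscent_iff] at ha
      omega

theorem length_ltimes_lt {i : B} {w : TwistedInv st} (ha : ¬ IsAscent st i w) :
    cs.length (ltimes st i w).1 < cs.length w.1 := by
  by_cases h : Commutes st i w
  · rw [ltimes_val_of_commutes h]
    rw [not_isAscent_iff] at ha
    omega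
  · have := length_ltimes_of_not_ascent ha h
    omega

/-! ### The Bruhat order on twisted involutions -/

open Classical in
/-- The shorter one of `w` and `s_i ⋉ w`. -/
noncomputable def ltimesMin (st : DiagramInvolution cs) (i : B) (w : TwistedInv st) :
    TwistedInv st :=
  if IsAscent st i w then w else ltimes st i w

/-- This reduces monotonicity on twisted involutions to the one-sided operations on `W`. At a
commuting descent `s w s* = w`, so the right-hand step leaves `s w` alone. -/
theorem ltimesMin_val (i : B) (w : TwistedInv st) :
    (ltimesMin st i w).1 = rightMin cs (starIdx st i) (leftMin cs i w.1) := by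
  have h2 := length_mul_aut_simple i w
  rw [rightMin_eq, leftMin, ← aut_simple_eq]
  by_cases ha : IsAscent st i w
  · rw [ltimesMin, if_pos ha]
    unfold IsAscent at ha
    rw [if_pos ha, h2, if_pos ha]
  · rw [ltimesMin, if_neg ha]
    by_cases h : Commutes st i w
    · rw [ltimes_val_of_commutes h]
      have h3 : cs.simple i * w.1 * st.aut (cs.simple i) = w.1 := by
        rw [h, mul_assoc, aut_simple_mul_self, mul_one]
      rw [not_isAscent_iff] at ha
      rw [if_neg (by omega : ¬ cs.length w.1 < cs.length (cs.simple i * w.1)), h3,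
        if_pos (by omega)]
    · have h3 := length_ltimes_of_not_ascent ha h
      rw [ltimes_val_of_not_commutes h] at h3 ⊢
      rw [not_isAscent_iff] at ha
      rw [if_neg (by omega : ¬ cs.length w.1 < cs.length (cs.simple i * w.1)),
        if_neg (by omega)]

theorem bruhatLE_ltimesMin {x y : TwistedInv st} (h : BruhatLE cs x.1 y.1) (i : B) :
    BruhatLE cs (ltimesMin st i x).1 (ltimesMin st i y).1 := by
  rw [ltimesMin_val, ltimesMin_val]
  exact (h.leftMin i).rightMin _

theorem ltimesMin_le (i : B) (w : TwistedInv st) : BruhatLE cs (ltimesMin st i w).1 w.1 := by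
  rw [ltimesMin_val]
  exact (rightMin_le _ _).trans (leftMin_le _ _)

theorem ltimes_le_of_not_ascent {i : B} {w : TwistedInv st} (ha : ¬ IsAscent st i w) :
    BruhatLE cs (ltimes st i w).1 w.1 := by
  simpa [ltimesMin, ha] using ltimesMin_le i w

/-! ### Ascending words and reduced expressions -/

/-- Each step of the `I_*`-expression goes up in the Bruhat order. -/
def IsAscending (st : DiagramInvolution cs) : List B → Prop
  | [] => True
  | i :: ω => IsAscent st i (ltimesWord st ω) ∧ IsAscending st ω

/-- Subword property: the first letter is kept exactly when it is a descent of `w`. -/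
theorem exists_sublist_of_le {ω : List B} (hω : IsAscending st ω) (w : TwistedInv st)
    (hw : BruhatLE cs w.1 (ltimesWord st ω).1) :
    ∃ ω' : List B, ω'.Sublist ω ∧ IsAscending st ω' ∧ ltimesWord st ω' = w := by
  induction ω generalizing w with
  | nil =>
    refine ⟨[], List.Sublist.refl _, trivial, Subtype.ext ?_⟩
    have : cs.length w.1 ≤ cs.length 1 := hw.length_le
    rw [cs.length_one] at this
    exact (cs.length_eq_zero_iff.1 (by omega)).symm
  | cons i ω ih =>
    obtain ⟨ha, hω⟩ := hω
    -- The letter `i` is a descent of the full word, so the minimum on the right is the value of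
    -- `ω`.
    have h := bruhatLE_ltimesMin hw i
    rw [ltimesWord, ltimesMin.eq_1 st i (ltimes st i _),
      if_neg (by rwa [isAscent_ltimes_iff, not_not]), ltimes_ltimes] at h
    obtain ⟨ω', h1, h2, h3⟩ := ih hω _ h
    by_cases hi : IsAscent st i w
    · rw [ltimesMin, if_pos hi] at h3
      exact ⟨ω', h1.cons _, h2, h3⟩
    · rw [ltimesMin, if_neg hi] at h3
      refine ⟨i :: ω', h1.cons_cons _, ⟨?_, h2⟩, ?_⟩
      · rwa [h3, isAscent_ltimes_iff]
      · rw [ltimesWord, h3, ltimes_ltimes]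

theorem exists_isAscending (w : TwistedInv st) :
    ∃ ω : List B, IsAscending st ω ∧ ltimesWord st ω = w := by
  induction hn : cs.length w.1 using Nat.strong_induction_on generalizing w with
  | _ n ih =>
    by_cases hw : w.1 = 1
    · exact ⟨[], trivial, Subtype.ext hw.symm⟩
    · obtain ⟨i, hi⟩ := cs.exists_leftDescent_of_ne_one hw
      have ha : ¬ IsAscent st i w := by
        unfold IsAscent
        unfold CoxeterSystem.IsLeftDescent at hi
        omega
      obtain ⟨ω, h1, h2⟩ := ih _ (hn ▸ length_ltimes_lt ha) (ltimes st i w) rfl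
      refine ⟨i :: ω, ⟨?_, h1⟩, ?_⟩
      · rwa [h2, isAscent_ltimes_iff]
      · rw [ltimesWord, h2, ltimes_ltimes]

/-- A descent is obtained by deleting letters from an ascending word. -/
theorem exists_sublist_ltimes {ω : List B} (hω : IsAscending st ω) {i : B}
    (hi : ¬ IsAscent st i (ltimesWord st ω)) :
    ∃ ω' : List B, ω'.Sublist ω ∧ ω'.length < ω.length ∧ IsAscending st ω' ∧
      ltimesWord st ω' = ltimes st i (ltimesWord st ω) := by
  obtain ⟨ω', h1, h2, h3⟩ := exists_sublist_of_le hω _ (ltimes_le_of_not_ascent hi)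
  refine ⟨ω', h1, lt_of_le_of_ne h1.length_le fun h => ?_, h2, h3⟩
  -- A sublist of full length is `ω` itself, but `s_i ⋉` strictly shortens its value.
  rw [h1.eq_of_length h] at h3
  have := length_ltimes_lt hi
  rw [← h3] at this
  omega

/-- The least length of an ascending word for `w`. -/
noncomputable def ascRank (w : TwistedInv st) : ℕ :=
  sInf {n | ∃ ω : List B, IsAscending st ω ∧ ltimesWord st ω = w ∧ ω.length = n}

theorem exists_length_eq_ascRank (w : TwistedInv st) :
    ∃ ω : List B, IsAscending st ω ∧ ltimesWord st ω = w ∧ ω.length = ascRank w := by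
  obtain ⟨ω, h1, h2⟩ := exists_isAscending w
  exact Nat.sInf_mem (s := {n | ∃ ω : List B, IsAscending st ω ∧ ltimesWord st ω = w ∧
    ω.length = n}) ⟨_, ω, h1, h2, rfl⟩

theorem ascRank_le {ω : List B} (hω : IsAscending st ω) :
    ascRank (ltimesWord st ω) ≤ ω.length :=
  Nat.sInf_le ⟨ω, hω, rfl, rfl⟩

theorem ascRank_ltimes_of_ascent {i : B} {w : TwistedInv st} (ha : IsAscent st i w) :
    ascRank (ltimes st i w) = ascRank w + 1 := by
  apply le_antisymm
  · obtain ⟨ω, h1, rfl, h3⟩ := exists_length_eq_ascRank w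
    rw [← h3]
    exact ascRank_le (ω := i :: ω) ⟨ha, h1⟩
  -- Exchange applied to a shortest ascending word of `s_i ⋉ w` gives a strictly shorter one for
  -- `w`.
  · obtain ⟨ω, h1, h2, h3⟩ := exists_length_eq_ascRank (ltimes st i w)
    obtain ⟨ω', -, h4, h5, h6⟩ := exists_sublist_ltimes h1 (i := i)
      (by rwa [h2, isAscent_ltimes_iff, not_not])
    rw [h2, ltimes_ltimes] at h6
    have := ascRank_le h5
    rw [h6] at this
    omega

theorem ascRank_ltimes_of_not_ascent {i : B} {w : TwistedInv st} (ha : ¬ IsAscent st i w) :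
    ascRank (ltimes st i w) + 1 = ascRank w := by
  rw [← ascRank_ltimes_of_ascent (isAscent_ltimes_iff.2 ha), ltimes_ltimes]

theorem ascRank_oneInv : ascRank (oneInv st) = 0 :=
  Nat.le_zero.1 (ascRank_le (st := st) (ω := []) trivial)

theorem IsAscending.ascRank_eq {ω : List B} (hω : IsAscending st ω) :
    ascRank (ltimesWord st ω) = ω.length := by
  induction ω with
  | nil => exact ascRank_oneInv
  | cons i ω ih => rw [ltimesWord, ascRank_ltimes_of_ascent hω.1, ih hω.2, List.length_cons]

theorem ascRank_ltimesWord_le (ω : List B) : ascRank (ltimesWord st ω) ≤ ω.length := by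
  induction ω with
  | nil => exact ascRank_oneInv.le
  | cons i ω ih =>
    rw [ltimesWord, List.length_cons]
    by_cases ha : IsAscent st i (ltimesWord st ω)
    · rw [ascRank_ltimes_of_ascent ha]
      omega
    · have := ascRank_ltimes_of_not_ascent ha
      omega

theorem isAscending_of_ascRank_eq {ω : List B} (h : ascRank (ltimesWord st ω) = ω.length) :
    IsAscending st ω := by
  induction ω with
  | nil => trivial
  | cons i ω ih =>
    rw [ltimesWord, List.length_cons] at h
    have hle := ascRank_ltimesWord_le (st := st) ω
    by_cases ha : IsAscent st i (ltimesWord st ω)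
    · rw [ascRank_ltimes_of_ascent ha] at h
      exact ⟨ha, ih (by omega)⟩
    · have := ascRank_ltimes_of_not_ascent ha
      omega

/-- Each letter moves `ascRank` by one, so the word length bounds it, with equality only if no
letter is a descent. -/
theorem isReducedExpr_iff {σ : List B} {z : TwistedInv st} :
    IsReducedExpr st σ z ↔ ltimesWord st σ = z ∧ IsAscending st σ := by
  constructor
  · rintro ⟨rfl, h⟩
    refine ⟨rfl, isAscending_of_ascRank_eq (le_antisymm (ascRank_ltimesWord_le σ) ?_)⟩
    obtain ⟨ω, h1, h2, h3⟩ := exists_length_eq_ascRank (ltimesWord st σ)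
    exact h3 ▸ h ω h2
  · rintro ⟨rfl, h⟩
    refine ⟨rfl, fun σ' h' => ?_⟩
    rw [← h.ascRank_eq, ← h']
    exact ascRank_ltimesWord_le σ'

theorem rho_eq_ascRank (w : TwistedInv st) : rho st w = ascRank w := by
  obtain ⟨ω, h1, rfl, h3⟩ := exists_length_eq_ascRank w
  rw [← h3, rho]
  apply le_antisymm
  · exact Nat.sInf_le ⟨ω, isReducedExpr_iff.2 ⟨rfl, h1⟩, rfl⟩
  · refine le_csInf ⟨_, ω, isReducedExpr_iff.2 ⟨rfl, h1⟩, rfl⟩ ?_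
    rintro k ⟨σ, hσ, rfl⟩
    rw [isReducedExpr_iff] at hσ
    rw [h3, ← hσ.1]
    exact ascRank_ltimesWord_le σ

theorem IsAscending.rho_eq {ω : List B} (hω : IsAscending st ω) :
    rho st (ltimesWord st ω) = ω.length := by
  rw [rho_eq_ascRank, hω.ascRank_eq]

theorem IsAscending.drop {ω : List B} (hω : IsAscending st ω) (n : ℕ) :
    IsAscending st (ω.drop n) := by
  induction ω generalizing n with
  | nil => simpa using hω
  | cons i ω ih =>
    cases n with
    | zero => exact hω
    | succ n => exact ih hω.2 n

end TwistedInvolutions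

/-! ### Completion to a reduced word, and the action on `a_1`. -/

section Expansion

variable {B W : Type*} [Group W] {M : CoxeterMatrix B} {cs : CoxeterSystem M W}
  {st : DiagramInvolution cs}

/-! ### The completion of an ascending word to a reduced word -/

open Classical in
/-- The letters `s_i*` of the non-commuting steps of an `I_*`-expression, in the order in which
they are appended. -/
noncomputable def tailWord (st : DiagramInvolution cs) : List B → List B
  | [] => []
  | i :: ω => if Commutes st i (ltimesWord st ω) then tailWord st ω
      else tailWord st ω ++ [starIdx st i]

theorem ltimesWord_val (ω : List B) :
    (ltimesWord st ω).1 = cs.wordProd (ω ++ tailWord st ω) := by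
  induction ω with
  | nil => simp [ltimesWord, tailWord, oneInv]
  | cons i ω ih =>
    by_cases h : Commutes st i (ltimesWord st ω)
    · rw [ltimesWord, ltimes_val_of_commutes h, tailWord, if_pos h, List.cons_append,
        cs.wordProd_cons, ih]
    · rw [ltimesWord, ltimes_val_of_not_commutes h, tailWord, if_neg h, List.cons_append,
        cs.wordProd_cons, ih, ← List.append_assoc, cs.wordProd_append _ [_],
        cs.wordProd_singleton, aut_simple_eq, mul_assoc]

theorem IsAscending.length_ltimesWord {ω : List B} (hω : IsAscending st ω) :
    cs.length (ltimesWord st ω).1 = ω.length + (tailWord st ω).length := by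
  induction ω with
  | nil => simp [ltimesWord, tailWord, oneInv]
  | cons i ω ih =>
    by_cases h : Commutes st i (ltimesWord st ω)
    · rw [ltimesWord, length_ltimes_of_commutes hω.1 h, ih hω.2, tailWord, if_pos h,
        List.length_cons]
      omega
    · rw [ltimesWord, length_ltimes_of_not_commutes hω.1 h, ih hω.2, tailWord, if_neg h]
      simp
      omega

theorem IsAscending.isReduced {ω : List B} (hω : IsAscending st ω) : cs.IsReduced ω := by
  have h : cs.IsReduced (ω ++ tailWord st ω) := by
    rw [CoxeterSystem.IsReduced, ← ltimesWord_val, hω.length_ltimesWord, List.length_append]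
  simpa using h.take ω.length

/-- New letters are appended on the right, so a single continuation serves every `z_a`, and the
`t_a` decrease. -/
theorem tailWord_drop_prefix (ω : List B) (n : ℕ) :
    tailWord st (ω.drop n) <+: tailWord st ω := by
  induction ω generalizing n with
  | nil => simp
  | cons i ω ih =>
    cases n with
    | zero => exact List.prefix_refl _
    | succ n =>
      refine (ih n).trans ?_
      rw [tailWord]
      split_ifs
      · exact List.prefix_refl _
      · exact List.prefix_append _ _

theorem IsAscending.isCompletion_tailWord {σ : List B} (hσ : IsAscending st σ) :
    IsCompletion st σ (tailWord st σ) (ltimesWord st σ) := by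
  refine ⟨by rw [hσ.length_ltimesWord, List.length_append],
    fun a => σ.length + (tailWord st (σ.drop a.1)).length, ?_, fun a => ?_⟩
  · intro a b hab
    have h : σ.drop b.1 = (σ.drop a.1).drop (b.1 - a.1) := by
      rw [List.drop_drop, Nat.add_sub_cancel' hab]
    have := (tailWord_drop_prefix (st := st) (σ.drop a.1) (b.1 - a.1)).length_le
    rw [← h] at this
    exact Nat.add_le_add_left this _
  · have ha := a.2
    have hp := (tailWord_drop_prefix (st := st) σ a.1)
    refine ⟨Nat.le_add_right _ _, fun h => by simp [h], ?_, ?_, ?_⟩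
    · rw [ltimesWord_val, List.take_length_add_append, List.drop_append_of_le_length ha.le,
        ← List.prefix_iff_eq_take.1 hp]
    · rw [(hσ.drop a).rho_eq, List.length_drop]
      omega
    · rw [(hσ.drop a).length_ltimesWord, List.length_drop]
      dsimp only
      omega

theorem wordProd_eq_of_map_simple_eq {ω ω' : List B} (h : ω.map cs.simple = ω'.map cs.simple) :
    cs.wordProd ω = cs.wordProd ω' := by
  rw [CoxeterSystem.wordProd, CoxeterSystem.wordProd, h]

/-- Each letter of `σ` adds at most one letter to the tail; once the shorter tail is known,
cancelling its product determines the new simple reflection. -/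
theorem map_simple_eq_of_wordProd_take (σ τ : List B) (hl : τ.length = (tailWord st σ).length)
    (h : ∀ a < σ.length, cs.wordProd (τ.take (tailWord st (σ.drop a)).length) =
      cs.wordProd (tailWord st (σ.drop a))) :
    τ.map cs.simple = (tailWord st σ).map cs.simple := by
  induction σ generalizing τ with
  | nil =>
    rw [List.eq_nil_of_length_eq_zero hl]
    rfl
  | cons i ω ih =>
    have h0 := h 0 (by simp)
    rw [List.drop_zero, ← hl, List.take_length] at h0
    have hs : ∀ a < ω.length, cs.wordProd (τ.take (tailWord st (ω.drop a)).length) =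
        cs.wordProd (tailWord st (ω.drop a)) := fun a ha => h (a + 1) (by simpa using ha)
    by_cases hc : Commutes st i (ltimesWord st ω)
    · rw [tailWord, if_pos hc] at hl ⊢
      exact ih τ hl hs
    · rw [tailWord, if_neg hc] at hl h0 ⊢
      rcases List.eq_nil_or_concat τ with rfl | ⟨τ', j, rfl⟩
      · simp at hl
      · have hl' : τ'.length = (tailWord st ω).length := by simpa using hl
        have e := ih τ' hl' fun a ha => by
          rw [← hs a ha, List.concat_eq_append, List.take_append_of_le_length]
          rw [hl']
          exact (tailWord_drop_prefix ω a).length_le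
        rw [List.concat_eq_append, cs.wordProd_append, cs.wordProd_append,
          wordProd_eq_of_map_simple_eq e, mul_right_inj, cs.wordProd_singleton,
          cs.wordProd_singleton] at h0
        simp [e, h0]

theorem IsAscending.map_simple_completion_eq {σ τ : List B} (hσ : IsAscending st σ)
    (h : IsCompletion st σ τ (ltimesWord st σ)) :
    τ.map cs.simple = (tailWord st σ).map cs.simple := by
  obtain ⟨hl, t, -, ht⟩ := h
  rw [hσ.length_ltimesWord, List.length_append] at hl
  refine map_simple_eq_of_wordProd_take σ τ (by omega) fun a ha => ?_
  obtain ⟨-, -, h1, -, h2⟩ := ht ⟨a, ha⟩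
  rw [(hσ.drop a).length_ltimesWord, List.length_drop] at h2
  -- The length condition leaves no freedom in `t`.
  have h3 : t ⟨a, ha⟩ = σ.length + (tailWord st (σ.drop a)).length := by
    rw [← h2]
    dsimp only
    omega
  rw [ltimesWord_val, h3, List.take_length_add_append, List.drop_append_of_le_length ha.le,
    cs.wordProd_append, cs.wordProd_append, mul_right_inj] at h1
  exact h1.symm

/-! ### The number of commuting steps -/

theorem commCount_add_length_tailWord (ω : List B) :
    commCount st ω + (tailWord st ω).length = ω.length := by
  induction ω with
  | nil => rfl
  | cons i ω ih =>
    rw [commCount, tailWord, List.length_cons]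
    split_ifs
    · omega
    · rw [List.length_append, List.length_singleton]
      omega

/-- For every reduced expression the count equals `2ρ - ℓ`. -/
theorem IsAscending.ellStar_eq {σ : List B} (hσ : IsAscending st σ) :
    ellStar st (ltimesWord st σ) = commCount st σ := by
  have : {n | ∃ σ' : List B, IsReducedExpr st σ' (ltimesWord st σ) ∧ commCount st σ' = n} =
      {commCount st σ} := by
    ext n
    simp only [Set.mem_ofPred_eq, Set.mem_singleton_iff]
    constructor
    · rintro ⟨σ', h, rfl⟩
      rw [isReducedExpr_iff] at h
      have h1 := hσ.length_ltimesWord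
      have h2 := h.2.length_ltimesWord
      have h3 := hσ.rho_eq
      have h4 := h.2.rho_eq
      have h5 := commCount_add_length_tailWord (st := st) σ
      have h6 := commCount_add_length_tailWord (st := st) σ'
      rw [h.1] at h2 h4
      omega
    · rintro rfl
      exact ⟨σ, isReducedExpr_iff.2 ⟨rfl, hσ⟩, rfl⟩
  rw [ellStar, this, csInf_singleton]

/-! ### The Hecke algebra -/

theorem heckeT_one : heckeT cs 1 = 1 := by
  rw [heckeT, RingQuot.mkAlgHom_rel Qu (HeckeRel.one (cs := cs)), map_one]

theorem heckeT_mul {w w' : W} (h : cs.length (w * w') = cs.length w + cs.length w') :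
    heckeT cs w * heckeT cs w' = heckeT cs (w * w') := by
  rw [heckeT, heckeT, heckeT, ← map_mul, RingQuot.mkAlgHom_rel Qu (HeckeRel.mul w w' h)]

theorem heckeT_wordProd {ω : List B} (hω : cs.IsReduced ω) :
    heckeT cs (cs.wordProd ω) = (ω.map fun i => heckeT cs (cs.simple i)).prod := by
  induction ω with
  | nil => simp [heckeT_one]
  | cons i ω ih =>
    have hω' : cs.IsReduced ω := by simpa using hω.drop 1
    rw [List.map_cons, List.prod_cons, ← ih hω', cs.wordProd_cons, heckeT_mul]
    rw [← cs.wordProd_cons, hω.eq, hω'.eq, cs.length_simple, List.length_cons, add_comm]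

/-! ### The involution module -/

theorem lvOp_aVec (i : B) (w : TwistedInv st) : lvOp st i (aVec st w) = lvVec st i w := by
  simp [lvOp, aVec]

theorem IsLVAction.eq_lvOp {φ : Hecke cs →ₐ[Qu] Module.End Qu (Mu st)} (hφ : IsLVAction st φ)
    (i : B) : φ (heckeT cs (cs.simple i)) = lvOp st i := by
  refine Finsupp.lhom_ext' fun w => LinearMap.ext_ring ?_
  exact (hφ i w).trans (lvOp_aVec i w).symm

theorem IsLVAction.apply_wordProd {φ : Hecke cs →ₐ[Qu] Module.End Qu (Mu st)}
    (hφ : IsLVAction st φ) {ω : List B} (hω : cs.IsReduced ω) :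
    φ (heckeT cs (cs.wordProd ω)) = (ω.map (lvOp st)).prod := by
  rw [heckeT_wordProd hω, map_list_prod, List.map_map]
  congr 2
  funext i
  exact hφ.eq_lvOp i

theorem toQu_mul (p q : ℤ[X]) : toQu (p * q) = toQu p * toQu q := map_mul _ _ _

theorem exists_lvVec_eq (i : B) (w : TwistedInv st) :
    ∃ p q : ℤ[X], lvVec st i w = toQu p • aVec st w + toQu q • aVec st (ltimes st i w) := by
  unfold lvVec
  split_ifs
  · exact ⟨X, X + 1, by simp [toQu]⟩
  · exact ⟨X ^ 2 - X - 1, X ^ 2 - X, by simp [toQu]⟩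
  · exact ⟨0, 1, by simp [toQu]⟩
  · exact ⟨X ^ 2 - 1, X ^ 2, by simp [toQu]⟩

/-- The `ℤ[u]`-combinations of the `a_w` with `w ∈ S` and coefficients in `u ℤ[u]`. -/
noncomputable def uLattice (st : DiagramInvolution cs) (S : Set (TwistedInv st)) : AddSubmonoid (Mu st) :=
  AddSubmonoid.closure {v | ∃ w ∈ S, ∃ p : ℤ[X], v = toQu (X * p) • aVec st w}

theorem smul_aVec_mem_uLattice {S : Set (TwistedInv st)} {w : TwistedInv st} (hw : w ∈ S)
    (p : ℤ[X]) : toQu (X * p) • aVec st w ∈ uLattice st S :=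
  AddSubmonoid.subset_closure ⟨w, hw, p, rfl⟩

theorem exists_finsupp_of_mem_uLattice {S : Set (TwistedInv st)} {v : Mu st}
    (hv : v ∈ uLattice st S) :
    ∃ L : TwistedInv st →₀ ℤ[X], (∀ w ∈ L.support, w ∈ S ∧ X ∣ L w) ∧
      v = L.sum fun w p => toQu p • aVec st w := by
  classical
  -- Divisibility is asked at every `w`, so that it passes to sums without tracking supports.
  suffices h : ∃ L : TwistedInv st →₀ ℤ[X], (∀ w, L w ≠ 0 → w ∈ S) ∧ (∀ w, X ∣ L w) ∧
      v = L.sum fun w p => toQu p • aVec st w by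
    obtain ⟨L, h1, h2, h3⟩ := h
    exact ⟨L, fun w hw => ⟨h1 w (Finsupp.mem_support_iff.1 hw), h2 w⟩, h3⟩
  induction hv using AddSubmonoid.closure_induction with
  | mem v hv =>
    obtain ⟨w, hw, p, rfl⟩ := hv
    refine ⟨Finsupp.single w (X * p), fun w' h => ?_, fun w' => ?_, ?_⟩
    · by_cases e : w = w'
      · exact e ▸ hw
      · simp [e] at h
    · rw [Finsupp.single_apply]
      split_ifs
      · exact dvd_mul_right _ _
      · exact dvd_zero _
    · rw [Finsupp.sum_single_index]
      simp [toQu]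
  | zero => exact ⟨0, by simp, by simp, by simp⟩
  | add v v' _ _ ih ih' =>
    obtain ⟨L, h1, h2, rfl⟩ := ih
    obtain ⟨L', h1', h2', rfl⟩ := ih'
    refine ⟨L + L', fun w h => ?_, fun w => dvd_add (h2 w) (h2' w), ?_⟩
    · by_contra hw
      apply h
      rw [Finsupp.add_apply, not_not.1 (mt (h1 w) hw), not_not.1 (mt (h1' w) hw), add_zero]
    · rw [Finsupp.sum_add_index']
      · simp [toQu]
      · intro w p q
        rw [toQu, map_add, add_smul]
        rfl

/-- Only the integrality of the Lusztig–Vogan coefficients matters: `u ℤ[u]` is an ideal of `ℤ[u]`.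
-/
theorem lvOp_mem_uLattice {S S' : Set (TwistedInv st)} (i : B) (h : ∀ w ∈ S, w ∈ S')
    (h' : ∀ w ∈ S, ltimes st i w ∈ S') {v : Mu st} (hv : v ∈ uLattice st S) :
    lvOp st i v ∈ uLattice st S' := by
  induction hv using AddSubmonoid.closure_induction with
  | mem v hv =>
    obtain ⟨w, hw, p, rfl⟩ := hv
    obtain ⟨q, q', hq⟩ := exists_lvVec_eq i w
    rw [map_smul, lvOp_aVec, hq, smul_add, smul_smul, smul_smul, ← toQu_mul, ← toQu_mul,
      mul_assoc, mul_assoc]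
    exact add_mem (smul_aVec_mem_uLattice (h w hw) _) (smul_aVec_mem_uLattice (h' w hw) _)
  | zero => simp
  | add v v' _ _ ih ih' =>
    rw [map_add]
    exact add_mem ih ih'

theorem IsAscending.bruhatLT_cons {i : B} {ω : List B} (h : IsAscending st (i :: ω)) :
    BruhatLT cs (cs.wordProd ω) (cs.wordProd (i :: ω)) := by
  refine ⟨bruhatLE_wordProd_of_sublist (List.sublist_cons_self i ω) h.isReduced, fun e => ?_⟩
  have := h.isReduced.eq
  rw [← e, h.2.isReduced.eq, List.length_cons] at this
  omega

theorem IsAscending.self_mem_precSet {i : B} {ω : List B} (h : IsAscending st (i :: ω)) :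
    ltimesWord st ω ∈ precSet st (i :: ω) (ltimesWord st (i :: ω)) := by
  refine ⟨?_, ω, isReducedExpr_iff.2 ⟨rfl, h.2⟩, h.bruhatLT_cons⟩
  rw [h.rho_eq, h.2.rho_eq]
  simp

theorem IsAscending.mem_precSet_cons {i : B} {ω : List B} (h : IsAscending st (i :: ω))
    {w : TwistedInv st} (hw : w ∈ precSet st ω (ltimesWord st ω)) :
    w ∈ precSet st (i :: ω) (ltimesWord st (i :: ω)) := by
  obtain ⟨hr, σ, hσ, hlt⟩ := hw
  refine ⟨hr.trans h.self_mem_precSet.1, σ, hσ, hlt.1.trans_lt h.bruhatLT_cons⟩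

/-- At an ascent both words gain the letter `i`, and `s_i` preserves the Bruhat relation because it
lengthens the larger side. At a descent, exchange gives a subword of `σ`, which is Bruhat-smaller
still. -/
theorem IsAscending.ltimes_mem_precSet_cons {i : B} {ω : List B} (h : IsAscending st (i :: ω))
    {w : TwistedInv st} (hw : w ∈ precSet st ω (ltimesWord st ω)) :
    ltimes st i w ∈ precSet st (i :: ω) (ltimesWord st (i :: ω)) := by
  obtain ⟨hr, σ, hσ, hlt⟩ := hw
  rw [isReducedExpr_iff] at hσ
  obtain ⟨rfl, hσ⟩ := hσ
  rw [hσ.rho_eq, h.2.rho_eq] at hr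
  by_cases ha : IsAscent st i (ltimesWord st σ)
  · have hσ' : IsAscending st (i :: σ) := ⟨ha, hσ⟩
    refine ⟨?_, i :: σ, isReducedExpr_iff.2 ⟨rfl, hσ'⟩, ?_, ?_⟩
    · rw [← ltimesWord, hσ'.rho_eq, h.rho_eq]
      simpa using hr
    · have hl := h.bruhatLT_cons.length_lt
      rw [cs.wordProd_cons] at hl
      rw [cs.wordProd_cons, cs.wordProd_cons]
      exact bruhatLE_simple_mul hlt.1 hl
    · rw [cs.wordProd_cons, cs.wordProd_cons]
      simpa using hlt.2
  · obtain ⟨σ', h1, h2, h3, h4⟩ := exists_sublist_ltimes hσ ha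
    refine ⟨?_, σ', isReducedExpr_iff.2 ⟨h4, h3⟩, ?_⟩
    · rw [← h4, h3.rho_eq, h.rho_eq, List.length_cons]
      omega
    · exact (bruhatLE_wordProd_of_sublist h1 hσ.isReduced).trans_lt
        (hlt.trans_le h.bruhatLT_cons.1)

theorem IsAscending.exists_mem_uLattice {σ : List B} (hσ : IsAscending st σ) :
    ∃ v ∈ uLattice st (precSet st σ (ltimesWord st σ)),
      (σ.map (lvOp st)).prod (aVec st (oneInv st)) =
        (uu + 1) ^ commCount st σ • aVec st (ltimesWord st σ) + v := by
  induction σ with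
  | nil => exact ⟨0, zero_mem _, by simp [commCount, ltimesWord]⟩
  | cons i ω ih =>
    obtain ⟨v, hv, e⟩ := ih hσ.2
    have hv' := lvOp_mem_uLattice i (fun w => hσ.mem_precSet_cons)
      (fun w => hσ.ltimes_mem_precSet_cons) hv
    have ha : cs.length (ltimesWord st ω).1 < cs.length (cs.simple i * (ltimesWord st ω).1) := hσ.1
    rw [List.map_cons, List.prod_cons, Module.End.mul_apply, e, map_add, map_smul, lvOp_aVec,
      commCount]
    by_cases hc : Commutes st i (ltimesWord st ω)
    -- The new error term `u (u + 1)^n a_w`, with `w` the previous leading index, comes from the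
    -- diagonal coefficient `u` of a commuting ascent.
    · refine ⟨_, add_mem (smul_aVec_mem_uLattice hσ.self_mem_precSet
        ((X + 1) ^ commCount st ω)) hv', ?_⟩
      have hq : toQu (X * (X + 1) ^ commCount st ω) = (uu + 1) ^ commCount st ω * uu := by
        simp [toQu, mul_comm]
      rw [lvVec, if_pos hc, if_pos ha, if_pos hc, hq, smul_add, smul_smul, smul_smul, add_comm 1,
        pow_succ, ltimesWord]
      abel
    · refine ⟨_, hv', ?_⟩
      rw [lvVec, if_neg hc, if_pos ha, if_neg hc, zero_add, ltimesWord]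

end Expansion

end InvolutionModule

theorem proposition2p9 {B : Type*} {W : Type*} [Group W] {M : CoxeterMatrix B}
    (cs : CoxeterSystem M W) (st : InvolutionModule.DiagramInvolution cs)
    (z : InvolutionModule.TwistedInv st) (σ : List B)
    (hσ : InvolutionModule.IsReducedExpr st σ z) :
    -- `z = s_{i_1} ⋉ ⋯ ⋉ s_{i_k} ⋉ 1 = s_{i_1} ⋯ s_{i_r}` with `k = ρ(z)` and `r = ℓ(z)`,
    -- where the simple reflections `s_{i_{k+1}}, …, s_{i_r}` are determined by `σ`
    σ.length = InvolutionModule.rho st z ∧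
    (∃ τ : List B,
      InvolutionModule.IsCompletion st σ τ z ∧
      z.1 = cs.wordProd (σ ++ τ) ∧ (σ ++ τ).length = cs.length z.1 ∧
      ∀ τ' : List B, InvolutionModule.IsCompletion st σ τ' z →
        τ'.map cs.simple = τ.map cs.simple) ∧
    -- `T_{σ_z} = T_{s_{i_1}} ⋯ T_{s_{i_k}}` in the Iwahori--Hecke algebra
    InvolutionModule.heckeT cs (cs.wordProd σ) =
      (σ.map fun i => InvolutionModule.heckeT cs (cs.simple i)).prod ∧
    -- the coefficients `L_w` for `w ≠ z`
    ∃ L : InvolutionModule.TwistedInv st →₀ Polynomial ℤ,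
      (∀ w ∈ L.support, w ∈ InvolutionModule.precSet st σ z ∧ Polynomial.X ∣ L w) ∧
      -- the expansion of `T_{s_{i_1}} (T_{s_{i_2}} (⋯ (T_{s_{i_k}} a_1)))`, where each `T_s`
      -- is the operator on `M_u` given by the Lusztig--Vogan formulas
      (σ.map (InvolutionModule.lvOp st)).prod
          (InvolutionModule.aVec st (InvolutionModule.oneInv st)) =
        (InvolutionModule.uu + 1) ^ InvolutionModule.ellStar st z • InvolutionModule.aVec st z +
          L.sum (fun w p => InvolutionModule.toQu p • InvolutionModule.aVec st w) ∧
      -- the expansion of `T_{σ_z} a_1` in the Lusztig--Vogan `H_u`-module structure on `M_u`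
      ∀ φ : InvolutionModule.Hecke cs →ₐ[InvolutionModule.Qu]
          Module.End InvolutionModule.Qu (InvolutionModule.Mu st),
        InvolutionModule.IsLVAction st φ →
        φ (InvolutionModule.heckeT cs (cs.wordProd σ))
            (InvolutionModule.aVec st (InvolutionModule.oneInv st)) =
          (InvolutionModule.uu + 1) ^ InvolutionModule.ellStar st z • InvolutionModule.aVec st z +
            L.sum (fun w p => InvolutionModule.toQu p • InvolutionModule.aVec st w) := by
  obtain ⟨rfl, ha⟩ := InvolutionModule.isReducedExpr_iff.1 hσ
  have hc := ha.isCompletion_tailWord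
  obtain ⟨v, hv, e⟩ := ha.exists_mem_uLattice
  obtain ⟨L, hL, rfl⟩ := InvolutionModule.exists_finsupp_of_mem_uLattice hv
  rw [← ha.ellStar_eq] at e
  refine ⟨ha.rho_eq.symm, ⟨_, hc, InvolutionModule.ltimesWord_val σ, hc.1,
    fun τ' h => ha.map_simple_completion_eq h⟩,
    InvolutionModule.heckeT_wordProd ha.isReduced, L, hL, e, fun φ hφ => ?_⟩
  rw [hφ.apply_wordProd ha.isReduced, e]
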